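/- Let $(\Omega,\mathcal F,(\mathcal F_t)_{t\ge 0},\mathbb Q)$ be a filtered probability space carrying two independent real standard $(\mathcal F_t)$-Brownian motions $W^E,W^I$ (the independent case $\rho=0$). Let $\tau_2>0$, let $\sigma_E,\sigma_I\in L^2([0,\tau_2])$ be deterministic real volatilities, let $F^E(0),F^I(0)>0$, and for $i\in\{E,I\}$ and $t\in[0,\tau_2]$ let $$Y_i(t)=\exp\Big(-\tfrac12\int_0^{t}\sigma_i^2(u)\,du+\int_0^{t}\sigma_i(u)\,dW^i(u)\Big),\qquad F^i(t)=F^i(0)\,Y_i(t),$$ so that $F^E,F^I$ are the geometric Brownian motions with $dF^i(t)=\sigma_i(t)F^i(t)\,dW^i(t)$. Assume that $\sigma_E$ is uniformly elliptic: there is $\eta>0$ such that $\xi\,\sigma_E(t)\sigma_E(t)\,\xi>\eta|\xi|^2$ for all $t\in[0,\tau_2]$ and all real $\xi\neq0$. Let $g,h:\mathbb R\to\mathbb R$ be measurable (not necessarily smooth or continuous) with $\mathbb E[g(F^E(\tau_2))^2]<\infty$ and $\mathbb E[h(F^I(\tau_2))^2]<\infty$. Given dates $t_1,\dots,t_n\in(0,\tau_2]$,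 one of which is $\tau_2$, let $$\Upsilon_n=\Big\{a\in L^2([0,\tau_2])\ :\ \int_0^{t_i}a(t)\,dt=1\ \text{ for all } i=1,\dots,n\Big\}.$$ Then for every $a\in\Upsilon_n$ the process $t\mapsto a(t)\,\big(\sigma_E(t)F^E(t)\big)^{-1}Y_E(t)$ is It\^o integrable on $[0,\tau_2]$ in the $L^2$ sense. With the Malliavin weight $$\pi^{\Delta_E}=\int_0^{\tau_2}a(t)\,\big(\sigma_E(t)F^E(t)\big)^{-1}Y_E(t)\,dW^E(t),$$ the random variable $g(F^E(\tau_2))\,h(F^I(\tau_2))\,\pi^{\Delta_E}$ is integrable, the price $\mathbb E\big[g(xY_E(\tau_2))\,h(F^I(\tau_2))\big]$ is well defined (its integrand is integrable) for every initial value $x>0$ of $F^E$, it is differentiable in $x$ at $x=F^E(0)$, and the energy delta is $$\frac{\partial}{\partial F^E(0)}\,\mathbb E\big[g(F^E(\tau_2))\,h(F^I(\tau_2))\big]=\mathbb E\big[g(F^E(\tau_2))\,h(F^I(\tau_2))\,\pi^{\Delta_E}\big].$$ -/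

import Mathlib

open MeasureTheory ProbabilityTheory Filter Topology Set
open scoped NNReal ENNReal

namespace QuantoDelta

noncomputable section

/-- `W` is a standard real Brownian motion relative to the filtration `ℱ`: a Brownian motion that
is adapted to `ℱ` and whose increments after time `s` are independent of `ℱ s`. -/
structure IsFiltrationBrownian {Ω : Type*} {mΩ : MeasurableSpace Ω} (ℱ : Filtration ℝ≥0 mΩ)
    (W : ℝ≥0 → Ω → ℝ) (Q : Measure Ω) : Prop extends IsBrownianReal W Q where
  adapted : ∀ t, Measurable[ℱ t] (W t)
  indep_increment : ∀ s t : ℝ≥0, s ≤ t →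
    Indep (MeasurableSpace.comap (fun ω => W t ω - W s ω) inferInstance) (ℱ s) Q

/-- Bounded simple adapted processes `∑ i < n, ξ i * 1_{(part i, part (i+1)]}`, with `ξ i`
measurable with respect to `ℱ (part i)`. -/
structure SimpleAdapted {Ω : Type*} {mΩ : MeasurableSpace Ω} (ℱ : Filtration ℝ≥0 mΩ) where
  n : ℕ
  part : ℕ → ℝ≥0
  mono : Monotone part
  ξ : ℕ → Ω → ℝ
  meas : ∀ i, Measurable[ℱ (part i)] (ξ i)
  bdd : ∃ C : ℝ, ∀ i ω, |ξ i ω| ≤ C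

/-- The value at time `t` of a simple adapted process. -/
def SimpleAdapted.val {Ω : Type*} {mΩ : MeasurableSpace Ω} {ℱ : Filtration ℝ≥0 mΩ}
    (V : SimpleAdapted ℱ) (t : ℝ) (ω : Ω) : ℝ :=
  ∑ i ∈ Finset.range V.n,
    (Ioc (V.part i : ℝ) (V.part (i + 1) : ℝ)).indicator (fun _ => V.ξ i ω) t

/-- The elementary stochastic integral `∫₀ᵀ V dW` of a simple adapted process. -/
def SimpleAdapted.integral {Ω : Type*} {mΩ : MeasurableSpace Ω} {ℱ : Filtration ℝ≥0 mΩ}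
    (V : SimpleAdapted ℱ) (W : ℝ≥0 → Ω → ℝ) (T : ℝ≥0) (ω : Ω) : ℝ :=
  ∑ i ∈ Finset.range V.n,
    V.ξ i ω * (W (min (V.part (i + 1)) T) ω - W (min (V.part i) T) ω)

/-- `J` is (a version of) the Itô integral `∫₀ᵀ u dW`: `u` is an `L²([0,T] × Ω)`-limit of simple
adapted processes whose elementary integrals converge to `J` in `L²(Ω)`. -/
def IsItoIntegral {Ω : Type*} {mΩ : MeasurableSpace Ω} (ℱ : Filtration ℝ≥0 mΩ)
    (W : ℝ≥0 → Ω → ℝ) (Q : Measure Ω) (T : ℝ≥0) (u : ℝ → Ω → ℝ) (J : Ω → ℝ) : Prop :=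
  AEStronglyMeasurable (fun p : ℝ × Ω => u p.1 p.2) ((volume.restrict (Ioc 0 (T : ℝ))).prod Q) ∧
  MemLp J 2 Q ∧
  ∃ V : ℕ → SimpleAdapted ℱ,
    Tendsto (fun k => eLpNorm (fun p : ℝ × Ω => (V k).val p.1 p.2 - u p.1 p.2) 2
      ((volume.restrict (Ioc 0 (T : ℝ))).prod Q)) atTop (𝓝 0) ∧
    Tendsto (fun k => eLpNorm (fun ω => (V k).integral W T ω - J ω) 2 Q) atTop (𝓝 0)

/-- `u` is Itô integrable on `[0,T]` in the `L²` sense. -/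
def ItoIntegrable {Ω : Type*} {mΩ : MeasurableSpace Ω} (ℱ : Filtration ℝ≥0 mΩ)
    (W : ℝ≥0 → Ω → ℝ) (Q : Measure Ω) (T : ℝ≥0) (u : ℝ → Ω → ℝ) : Prop :=
  ∃ J : Ω → ℝ, IsItoIntegral ℱ W Q T u J

open Classical in
/-- The Itô integral `∫₀ᵀ u dW` (a chosen version; zero if `u` is not Itô integrable). -/
def itoIntegral {Ω : Type*} {mΩ : MeasurableSpace Ω} (ℱ : Filtration ℝ≥0 mΩ)
    (W : ℝ≥0 → Ω → ℝ) (Q : Measure Ω) (T : ℝ≥0) (u : ℝ → Ω → ℝ) : Ω → ℝ :=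
  if H : ItoIntegrable ℱ W Q T u then H.choose else 0

/-- The stochastic exponential
`Y(t) = exp (-1/2 ∫₀ᵗ σ(u)² du + ∫₀ᵗ σ(u) dW(u))` of a deterministic volatility `σ`. -/
def stochExp {Ω : Type*} {mΩ : MeasurableSpace Ω} (ℱ : Filtration ℝ≥0 mΩ)
    (W : ℝ≥0 → Ω → ℝ) (Q : Measure Ω) (σ : ℝ → ℝ) (t : ℝ≥0) (ω : Ω) : ℝ :=
  Real.exp (-(1 / 2) * (∫ u in (0 : ℝ)..(t : ℝ), σ u ^ 2)
    + itoIntegral ℱ W Q t (fun u _ => σ u) ω)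

/-- The futures price with initial value `x` and `dF(t) = σ(t) F(t) dW(t)`, i.e. the geometric
Brownian motion `F(t) = x exp (-1/2 ∫₀ᵗ σ(u)² du + ∫₀ᵗ σ(u) dW(u))`. -/
def futuresPrice {Ω : Type*} {mΩ : MeasurableSpace Ω} (ℱ : Filtration ℝ≥0 mΩ)
    (W : ℝ≥0 → Ω → ℝ) (Q : Measure Ω) (σ : ℝ → ℝ) (x : ℝ) (t : ℝ≥0) (ω : Ω) : ℝ :=
  x * stochExp ℱ W Q σ t ω

/-- Uniform ellipticity on `[0,T]` of a (scalar) volatility. -/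
def UniformlyElliptic (σ : ℝ → ℝ) (T : ℝ≥0) : Prop :=
  ∃ η : ℝ, 0 < η ∧ ∀ t ∈ Icc (0 : ℝ) T, ∀ ξ : ℝ, ξ ≠ 0 → η * |ξ| ^ 2 < ξ * σ t * σ t * ξ

/-- The set of `a ∈ L²([0,T])` with `∫₀^{s i} a(t) dt = 1` for every date `s i`. -/
def Upsilon {n : ℕ} (s : Fin n → ℝ) (T : ℝ≥0) : Set (ℝ → ℝ) :=
  {a | MemLp a 2 (volume.restrict (Icc 0 (T : ℝ))) ∧ ∀ i, ∫ t in (0 : ℝ)..(s i), a t = 1}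

/-- The integrand `a(t) (σ(t) F(t))⁻¹ Y(t)` of the delta weight; here `σ(t) F(t)` is the diffusion
coefficient of the price with initial value `x`, and `Y` is its first variation process. -/
def deltaIntegrand {Ω : Type*} {mΩ : MeasurableSpace Ω} (ℱ : Filtration ℝ≥0 mΩ)
    (W : ℝ≥0 → Ω → ℝ) (Q : Measure Ω) (σ : ℝ → ℝ) (x : ℝ) (a : ℝ → ℝ) (t : ℝ) (ω : Ω) : ℝ :=
  a t * ((σ t * futuresPrice ℱ W Q σ x t.toNNReal ω)⁻¹ * stochExp ℱ W Q σ t.toNNReal ω)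

/-- The Malliavin weight `∫₀ᵀ a(t) (σ(t) F(t))⁻¹ Y(t) dW(t)`. -/
def deltaWeight {Ω : Type*} {mΩ : MeasurableSpace Ω} (ℱ : Filtration ℝ≥0 mΩ)
    (W : ℝ≥0 → Ω → ℝ) (Q : Measure Ω) (T : ℝ≥0) (σ : ℝ → ℝ) (x : ℝ) (a : ℝ → ℝ) : Ω → ℝ :=
  itoIntegral ℱ W Q T (deltaIntegrand ℱ W Q σ x a)

end

end QuantoDelta

/-!
The stochastic exponential cancels in the integrand of the weight, so the weight is the integral of
the deterministic function `a / (xE σE)` (`QuantoDelta.deltaIntegrand_eq`). The statement is thus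
one about the Gaussian variables `X = ∫ σE dWE` and `B = ∫ a / (xE σE) dWE`, and `Z = ∫ σI dWI`.

The definition of the integral admits random approximating processes and chooses a version. The
polarized Itô isometry (`QuantoDelta.IsItoIntegral.integral_mul`) shows that versions agree almost
surely, so deterministic step functions may be used instead. Their integrals lie in the linear span
of the Brownian motion, whence existence, joint Gaussianity of `(X, B)`
(`QuantoDelta.IsItoIntegral.hasGaussianLaw_prodMk`) and measurability, up to null sets, with respect
to the σ-algebra of the driving Brownian motion. The last makes `(X, B)` independent of `Z`.

The price therefore factors as `E[g(x e^{-v/2 + X})] E[h]` with `v = ∫ σE²`. In the variable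
`θ = log (x / xE)` the first factor is `E[G(X + θ)]`, and the Cameron–Martin formula moves `θ` from
the merely measurable `G` to an exponential density, which gives the derivative `E[G(X) X] / v` at
`θ = 0` (`QuantoDelta.hasDerivAt_integral_comp_add_gaussianReal`). On the other side,
Gaussian regression of `B` on `X` (`QuantoDelta.integral_comp_mul_of_hasGaussianLaw`) gives
`E[G(X) B] = Cov(X, B) E[G(X) X] / v`, and the normalization `∫ a = 1` makes `Cov(X, B) = 1 / xE`,
which is the factor that the chain rule produces for `log (x / xE)`.
-/

namespace QuantoDelta

variable {Ω : Type*} {mΩ : MeasurableSpace Ω} {Q : Measure Ω} {ℱ : Filtration ℝ≥0 mΩ}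
  {W : ℝ≥0 → Ω → ℝ}

/-! ### Convergence in `L²` -/

lemma inner_toLp_toLp {α : Type*} {mα : MeasurableSpace α} {μ : Measure α} {f g : α → ℝ}
    (hf : MemLp f 2 μ) (hg : MemLp g 2 μ) :
    inner ℝ (hf.toLp f) (hg.toLp g) = ∫ x, f x * g x ∂μ := by
  rw [L2.inner_def]
  refine integral_congr_ae ?_
  filter_upwards [hf.coeFn_toLp, hg.coeFn_toLp] with x hx hy
  simp [hx, hy, mul_comm]

lemma tendsto_integral_mul_of_tendsto_eLpNorm {α : Type*} {mα : MeasurableSpace α} {μ : Measure α}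
    {f g : ℕ → α → ℝ} {f' g' : α → ℝ} (hf : ∀ k, MemLp (f k) 2 μ) (hg : ∀ k, MemLp (g k) 2 μ)
    (hf' : MemLp f' 2 μ) (hg' : MemLp g' 2 μ)
    (hft : Tendsto (fun k => eLpNorm (fun x => f k x - f' x) 2 μ) atTop (𝓝 0))
    (hgt : Tendsto (fun k => eLpNorm (fun x => g k x - g' x) 2 μ) atTop (𝓝 0)) :
    Tendsto (fun k => ∫ x, f k x * g k x ∂μ) atTop (𝓝 (∫ x, f' x * g' x ∂μ)) := by
  have h1 := (Lp.tendsto_Lp_iff_tendsto_eLpNorm'' f hf f' hf').2 hft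
  have h2 := (Lp.tendsto_Lp_iff_tendsto_eLpNorm'' g hg g' hg').2 hgt
  have h3 := h1.inner (𝕜 := ℝ) h2
  simpa only [inner_toLp_toLp] using h3

lemma memLp_of_tendsto_eLpNorm {α : Type*} {mα : MeasurableSpace α} {μ : Measure α}
    {f : ℕ → α → ℝ} {f' : α → ℝ} (hf : ∀ k, MemLp (f k) 2 μ) (hf' : AEStronglyMeasurable f' μ)
    (hft : Tendsto (fun k => eLpNorm (fun x => f k x - f' x) 2 μ) atTop (𝓝 0)) :
    MemLp f' 2 μ := by
  obtain ⟨k, hk⟩ := (hft.eventually_lt_const (u := 1) one_pos).exists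
  have h1 : MemLp (fun x => f k x - f' x) 2 μ :=
    ⟨(hf k).1.sub hf', hk.trans ENNReal.one_lt_top⟩
  convert (hf k).sub h1 using 1
  ext x
  simp

/-! ### Moments of Brownian increments -/

namespace IsFiltrationBrownian

lemma isProbabilityMeasure (hW : IsFiltrationBrownian ℱ W Q) : IsProbabilityMeasure Q :=
  hW.isGaussianProcess.isProbabilityMeasure

lemma measurable_increment (hW : IsFiltrationBrownian ℱ W Q) (s t : ℝ≥0) :
    Measurable (fun ω => W t ω - W s ω) :=
  ((hW.adapted t).mono (ℱ.le t) le_rfl).sub ((hW.adapted s).mono (ℱ.le s) le_rfl)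

lemma memLp_increment (hW : IsFiltrationBrownian ℱ W Q) (s t : ℝ≥0) :
    MemLp (fun ω => W t ω - W s ω) 2 Q :=
  hW.isGaussianProcess.hasGaussianLaw_fun_sub.memLp_two

lemma integral_increment (hW : IsFiltrationBrownian ℱ W Q) (s t : ℝ≥0) :
    ∫ ω, W t ω - W s ω ∂Q = 0 := by
  rw [integral_sub (hW.integrable_eval t) (hW.integrable_eval s), hW.integral_eval,
    hW.integral_eval, sub_zero]

lemma integral_increment_sq (hW : IsFiltrationBrownian ℱ W Q) {s t : ℝ≥0} (hst : s ≤ t) :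
    ∫ ω, (W t ω - W s ω) ^ 2 ∂Q = t - s := by
  have h : Var[fun ω => W t ω - W s ω; Q] = nndist t.1 s.1 :=
    (hW.hasLaw_sub t s).variance_eq.trans variance_id_gaussianReal
  rw [variance_of_integral_eq_zero (hW.memLp_increment s t).aemeasurable
    (hW.integral_increment s t)] at h
  rw [h, coe_nndist, Real.dist_eq, abs_of_nonneg]
  · rfl
  · exact sub_nonneg.2 (by exact_mod_cast hst)

lemma indepFun_increment (hW : IsFiltrationBrownian ℱ W Q) {s t : ℝ≥0} (hst : s ≤ t)
    {X : Ω → ℝ} (hX : Measurable[ℱ s] X) :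
    IndepFun X (fun ω => W t ω - W s ω) Q := by
  rw [IndepFun_iff_Indep]
  exact indep_of_indep_of_le_left (hW.indep_increment s t hst).symm hX.comap_le

lemma integral_mul_increment (hW : IsFiltrationBrownian ℱ W Q) {s t : ℝ≥0} (hst : s ≤ t)
    {X : Ω → ℝ} (hX : Measurable[ℱ s] X) :
    ∫ ω, X ω * (W t ω - W s ω) ∂Q = 0 := by
  rw [(hW.indepFun_increment hst hX).integral_fun_mul_eq_mul_integral
    (hX.mono (ℱ.le s) le_rfl).aestronglyMeasurable
    (hW.measurable_increment s t).aestronglyMeasurable, hW.integral_increment, mul_zero]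

lemma integral_mul_increment_sq (hW : IsFiltrationBrownian ℱ W Q) {s t : ℝ≥0} (hst : s ≤ t)
    {X : Ω → ℝ} (hX : Measurable[ℱ s] X) :
    ∫ ω, X ω * (W t ω - W s ω) ^ 2 ∂Q = (∫ ω, X ω ∂Q) * (t - s) := by
  have h : IndepFun X (fun ω => (W t ω - W s ω) ^ 2) Q :=
    (hW.indepFun_increment hst hX).comp (φ := id) (ψ := fun x => x ^ 2) measurable_id
      (measurable_id.pow_const 2)
  rw [h.integral_fun_mul_eq_mul_integral (hX.mono (ℱ.le s) le_rfl).aestronglyMeasurable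
    ((hW.measurable_increment s t).pow_const 2).aestronglyMeasurable, hW.integral_increment_sq hst]

lemma memLp_mul_increment (hW : IsFiltrationBrownian ℱ W Q) {X : Ω → ℝ}
    (hX : Measurable X) {C : ℝ} (hC : ∀ ω, |X ω| ≤ C) (s t : ℝ≥0) :
    MemLp (fun ω => X ω * (W t ω - W s ω)) 2 Q := by
  have : IsProbabilityMeasure Q := hW.isProbabilityMeasure
  exact (hW.memLp_increment s t).mul' (memLp_top_of_bound hX.aestronglyMeasurable C
    (ae_of_all _ fun ω => by simpa using hC ω))

/-- The covariance of two weighted Brownian increments. The later of the two left end points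
splits the increments into a past part, which is orthogonal to the future, and the common part. -/
lemma integral_mul_increment_mul_increment (hW : IsFiltrationBrownian ℱ W Q) {a b c d : ℝ≥0}
    (hab : a ≤ b) (hcd : c ≤ d) {X Y : Ω → ℝ} (hX : Measurable[ℱ a] X) (hY : Measurable[ℱ c] Y)
    {C D : ℝ} (hC : ∀ ω, |X ω| ≤ C) (hD : ∀ ω, |Y ω| ≤ D) :
    ∫ ω, (X ω * (W b ω - W a ω)) * (Y ω * (W d ω - W c ω)) ∂Q
      = (∫ ω, X ω * Y ω ∂Q) * max 0 ((min b d : ℝ≥0) - (max a c : ℝ≥0) : ℝ) := by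
  wlog hac : a ≤ c generalizing a b c d X Y C D
  · have h := this hcd hab hY hX hD hC (le_of_not_ge hac)
    simp_rw [mul_comm (X _) (Y _), min_comm b d, max_comm a c, ← h]
    exact integral_congr_ae (ae_of_all _ fun ω => mul_comm _ _)
  have hXc : Measurable[ℱ c] X := hX.mono (ℱ.mono hac) le_rfl
  have hWm : ∀ {r}, r ≤ c → Measurable[ℱ c] (W r) := fun hr =>
    (hW.adapted _).mono (ℱ.mono hr) le_rfl
  rw [max_eq_right hac]
  rcases le_total b c with hbc | hcb
  · have h0 : max 0 ((min b d : ℝ≥0) - c : ℝ) = 0 := by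
      apply max_eq_left
      have : min b d ≤ c := (min_le_left _ _).trans hbc
      exact sub_nonpos.2 (by exact_mod_cast this)
    rw [h0, mul_zero, ← hW.integral_mul_increment hcd
      (((hXc.mul ((hWm hbc).sub (hWm hac))).mul hY))]
    refine integral_congr_ae (ae_of_all _ fun ω => ?_)
    simp only [Pi.mul_apply, Pi.sub_apply]
    ring
  · have hm : c ≤ min b d := le_min hcb hcd
    have hmM : min b d ≤ max b d := min_le_max
    have hX' : Measurable X := hX.mono (ℱ.le a) le_rfl
    have hY' : Measurable Y := hY.mono (ℱ.le c) le_rfl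
    have hXY : ∀ ω, |X ω * Y ω| ≤ C * D := fun ω => by
      rw [abs_mul]
      exact mul_le_mul (hC ω) (hD ω) (abs_nonneg _) ((abs_nonneg _).trans (hC ω))
    have i1 : Integrable (fun ω => (X ω * Y ω * (W c ω - W a ω)) * (W d ω - W c ω)) Q :=
      (hW.memLp_mul_increment (hX'.mul hY') hXY _ _).integrable_mul (hW.memLp_increment c d)
    have i2 : Integrable (fun ω => (X ω * Y ω) * (W (min b d) ω - W c ω) ^ 2) Q := by
      simpa only [sq, mul_assoc, Pi.mul_def] using
        (hW.memLp_mul_increment (hX'.mul hY') hXY c (min b d)).integrable_mul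
          (hW.memLp_increment c (min b d))
    have i3 : Integrable (fun ω => (X ω * Y ω * (W (min b d) ω - W c ω)) *
        (W (max b d) ω - W (min b d) ω)) Q :=
      (hW.memLp_mul_increment (hX'.mul hY') hXY _ _).integrable_mul (hW.memLp_increment _ _)
    have e : ∀ ω, (X ω * (W b ω - W a ω)) * (Y ω * (W d ω - W c ω))
        = (X ω * Y ω * (W c ω - W a ω)) * (W d ω - W c ω)
          + (X ω * Y ω) * (W (min b d) ω - W c ω) ^ 2
          + (X ω * Y ω * (W (min b d) ω - W c ω)) * (W (max b d) ω - W (min b d) ω) := by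
      intro ω
      rcases le_total b d with h | h
      · rw [min_eq_left h, max_eq_right h]; ring
      · rw [min_eq_right h, max_eq_left h]; ring
    have hmeas : Measurable[ℱ (min b d)] (fun ω => X ω * Y ω * (W (min b d) ω - W c ω)) :=
      ((hXc.mul hY).mono (ℱ.mono hm) le_rfl).mul
        ((hW.adapted _).sub ((hW.adapted c).mono (ℱ.mono hm) le_rfl))
    simp_rw [e]
    rw [integral_add (f := fun ω => _ + _) (i1.add i2) i3, integral_add i1 i2,
      hW.integral_mul_increment (X := fun ω => X ω * Y ω * (W c ω - W a ω)) hcd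
        ((hXc.mul hY).mul ((hWm le_rfl).sub (hWm hac))),
      hW.integral_mul_increment_sq (X := fun ω => X ω * Y ω) hm
        (hXc.mul hY), hW.integral_mul_increment hmM hmeas,
      zero_add, add_zero, max_eq_right (sub_nonneg.2 (by exact_mod_cast hm))]

end IsFiltrationBrownian

/-! ### The Itô isometry -/

namespace SimpleAdapted

lemma val_eq_sum_mul (V : SimpleAdapted ℱ) (t : ℝ) (ω : Ω) :
    V.val t ω = ∑ i ∈ Finset.range V.n,
      (Ioc (V.part i : ℝ) (V.part (i + 1) : ℝ)).indicator 1 t * V.ξ i ω := by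
  refine Finset.sum_congr rfl fun i _ => ?_
  by_cases h : t ∈ Ioc (V.part i : ℝ) (V.part (i + 1) : ℝ) <;> simp [h]

lemma memLp_ξ [IsFiniteMeasure Q] (V : SimpleAdapted ℱ) (i : ℕ) (p : ℝ≥0∞) :
    MemLp (V.ξ i) p Q := by
  obtain ⟨C, hC⟩ := V.bdd
  exact MemLp.of_bound ((V.meas i).mono (ℱ.le _) le_rfl).aestronglyMeasurable C
    (ae_of_all _ fun ω => by simpa using hC i ω)

lemma memLp_indicator (T : ℝ≥0) (a b : ℝ) (p : ℝ≥0∞) :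
    MemLp ((Ioc a b).indicator (1 : ℝ → ℝ)) p (volume.restrict (Ioc 0 (T : ℝ))) :=
  MemLp.of_bound (measurable_one.indicator measurableSet_Ioc).aestronglyMeasurable 1
    (ae_of_all _ fun t => by
      by_cases h : t ∈ Ioc a b <;> simp [h])

lemma memLp_val [IsFiniteMeasure Q] (V : SimpleAdapted ℱ) (T : ℝ≥0) :
    MemLp (fun p : ℝ × Ω => V.val p.1 p.2) 2 ((volume.restrict (Ioc 0 (T : ℝ))).prod Q) := by
  simp_rw [val_eq_sum_mul]
  refine memLp_finsetSum _ fun i _ => ?_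
  exact ((V.memLp_ξ i 2).comp_snd _).mul' ((memLp_indicator T _ _ ∞).comp_fst Q)

lemma memLp_integral (V : SimpleAdapted ℱ) (hW : IsFiltrationBrownian ℱ W Q) (T : ℝ≥0) :
    MemLp (V.integral W T) 2 Q := by
  obtain ⟨C, hC⟩ := V.bdd
  exact memLp_finsetSum _ fun i _ =>
    hW.memLp_mul_increment ((V.meas i).mono (ℱ.le _) le_rfl) (hC i) _ _

lemma integral_indicator_mul_indicator (T a b c d : ℝ≥0) :
    ∫ t in Ioc 0 (T : ℝ), (Ioc (a : ℝ) b).indicator 1 t * (Ioc (c : ℝ) d).indicator 1 t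
      = max 0 (((min (min b T) (min d T) : ℝ≥0) : ℝ) - (max (min a T) (min c T) : ℝ≥0)) := by
  have h : ∀ t : ℝ, (Ioc (a : ℝ) b).indicator (1 : ℝ → ℝ) t * (Ioc (c : ℝ) d).indicator 1 t
      = (Ioc (a : ℝ) b ∩ Ioc (c : ℝ) d).indicator 1 t := fun t => by
    rw [inter_indicator_one]; rfl
  simp_rw [h]
  rw [integral_indicator_one (measurableSet_Ioc.inter measurableSet_Ioc), measureReal_def,
    Measure.restrict_apply (measurableSet_Ioc.inter measurableSet_Ioc), Ioc_inter_Ioc,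
    Ioc_inter_Ioc, Real.volume_Ioc, ENNReal.toReal_ofReal', max_comm]
  push_cast
  have h1 := a.coe_nonneg
  have h2 := c.coe_nonneg
  have h3 := T.coe_nonneg
  rw [max_eq_left (h1.trans (le_max_left _ _))]
  clear h
  generalize (a : ℝ) = a, (b : ℝ) = b, (c : ℝ) = c, (d : ℝ) = d, (T : ℝ) = T at *
  grind

/-- Polarized Itô isometry for simple adapted processes. -/
lemma integral_integral_mul_integral (hW : IsFiltrationBrownian ℱ W Q) (V V' : SimpleAdapted ℱ)
    (T : ℝ≥0) :
    ∫ ω, V.integral W T ω * V'.integral W T ω ∂Q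
      = ∫ p, V.val p.1 p.2 * V'.val p.1 p.2 ∂((volume.restrict (Ioc 0 (T : ℝ))).prod Q) := by
  have : IsProbabilityMeasure Q := hW.isProbabilityMeasure
  obtain ⟨C, hC⟩ := V.bdd
  obtain ⟨D, hD⟩ := V'.bdd
  have hm : ∀ (U : SimpleAdapted ℱ) i, Measurable (U.ξ i) := fun U i =>
    (U.meas i).mono (ℱ.le _) le_rfl
  have hle : ∀ (U : SimpleAdapted ℱ) i, min (U.part i) T ≤ min (U.part (i + 1)) T := fun U i =>
    min_le_min_right _ (U.mono i.le_succ)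
  have hi : ∀ i j, Integrable (fun ω =>
      V.ξ i ω * (W (min (V.part (i + 1)) T) ω - W (min (V.part i) T) ω) *
        (V'.ξ j ω * (W (min (V'.part (j + 1)) T) ω - W (min (V'.part j) T) ω))) Q := fun i j =>
    (hW.memLp_mul_increment (hm V i) (hC i) _ _).integrable_mul
        (hW.memLp_mul_increment (hm V' j) (hD j) _ _)
  have hv : ∀ (U : SimpleAdapted ℱ) i, MemLp (fun p : ℝ × Ω =>
      (Ioc (U.part i : ℝ) (U.part (i + 1))).indicator 1 p.1 * U.ξ i p.2) 2
      ((volume.restrict (Ioc 0 (T : ℝ))).prod Q) := fun U i =>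
    ((U.memLp_ξ i 2).comp_snd _).mul' ((memLp_indicator T _ _ ∞).comp_fst Q)
  have hi' : ∀ i j, Integrable (fun p : ℝ × Ω =>
      (Ioc (V.part i : ℝ) (V.part (i + 1))).indicator 1 p.1 * V.ξ i p.2 *
      ((Ioc (V'.part j : ℝ) (V'.part (j + 1))).indicator 1 p.1 * V'.ξ j p.2))
      ((volume.restrict (Ioc 0 (T : ℝ))).prod Q) := fun i j => (hv V i).integrable_mul (hv V' j)
  simp only [SimpleAdapted.integral, val_eq_sum_mul, Finset.sum_mul_sum]
  rw [integral_finsetSum _ fun i _ => integrable_finsetSum _ fun j _ => hi i j,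
    integral_finsetSum _ fun i _ => integrable_finsetSum _ fun j _ => hi' i j]
  refine Finset.sum_congr rfl fun i _ => ?_
  rw [integral_finsetSum _ fun j _ => hi i j, integral_finsetSum _ fun j _ => hi' i j]
  refine Finset.sum_congr rfl fun j _ => ?_
  clear hi hi' hv
  have hr : ∀ p : ℝ × Ω, (Ioc (V.part i : ℝ) (V.part (i + 1))).indicator 1 p.1 * V.ξ i p.2 *
      ((Ioc (V'.part j : ℝ) (V'.part (j + 1))).indicator 1 p.1 * V'.ξ j p.2)
      = ((Ioc (V.part i : ℝ) (V.part (i + 1))).indicator 1 p.1 *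
        (Ioc (V'.part j : ℝ) (V'.part (j + 1))).indicator 1 p.1) *
        (V.ξ i p.2 * V'.ξ j p.2) := fun p => by ring
  simp_rw [hr]
  rw [integral_prod_mul (fun t : ℝ => (Ioc (V.part i : ℝ) (V.part (i + 1))).indicator 1 t *
        (Ioc (V'.part j : ℝ) (V'.part (j + 1))).indicator 1 t)
        (fun ω => V.ξ i ω * V'.ξ j ω), integral_indicator_mul_indicator]
  -- An increment that starts after `T` vanishes, and its weight need not be `ℱ T`-measurable.
  by_cases hi : V.part i ≤ T ∧ V'.part j ≤ T
  · rw [hW.integral_mul_increment_mul_increment (hle V i) (hle V' j)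
      (by rw [min_eq_left hi.1]; exact V.meas i) (by rw [min_eq_left hi.2]; exact V'.meas j)
      (hC i) (hD j), mul_comm]
  · have hz : max 0 (((min (min (V.part (i + 1)) T) (min (V'.part (j + 1)) T) : ℝ≥0) : ℝ)
        - (max (min (V.part i) T) (min (V'.part j) T) : ℝ≥0)) = 0 := by
      apply max_eq_left
      rw [sub_nonpos, NNReal.coe_le_coe]
      rw [not_and_or, not_le, not_le] at hi
      rcases hi with hi | hi
      · exact (min_le_left _ _).trans ((min_le_right _ _).trans
          ((min_eq_right hi.le).ge.trans (le_max_left _ _)))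
      · exact (min_le_left _ _).trans ((min_le_right _ _).trans
          ((min_eq_right hi.le).ge.trans (le_max_right _ _)))
    rw [hz, zero_mul]
    refine integral_eq_zero_of_ae (ae_of_all _ fun ω => ?_)
    rw [not_and_or, not_le, not_le] at hi
    rcases hi with hi | hi
    · have h' := hi.le.trans (V.mono i.le_succ)
      simp [min_eq_right hi.le, min_eq_right h']
    · have h' := hi.le.trans (V'.mono j.le_succ)
      simp [min_eq_right hi.le, min_eq_right h']

end SimpleAdapted

namespace IsItoIntegral

variable {T : ℝ≥0} {u u' : ℝ → Ω → ℝ} {J J' : Ω → ℝ}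

/-- Polarized Itô isometry. -/
lemma integral_mul (hW : IsFiltrationBrownian ℱ W Q) (h : IsItoIntegral ℱ W Q T u J)
    (h' : IsItoIntegral ℱ W Q T u' J') :
    ∫ ω, J ω * J' ω ∂Q
      = ∫ p, u p.1 p.2 * u' p.1 p.2 ∂((volume.restrict (Ioc 0 (T : ℝ))).prod Q) := by
  have : IsProbabilityMeasure Q := hW.isProbabilityMeasure
  obtain ⟨hu, hJ, V, hV, hI⟩ := h
  obtain ⟨hu', hJ', V', hV', hI'⟩ := h'
  have h1 := tendsto_integral_mul_of_tendsto_eLpNorm (fun k => (V k).memLp_integral hW T)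
    (fun k => (V' k).memLp_integral hW T) hJ hJ' hI hI'
  have h2 := tendsto_integral_mul_of_tendsto_eLpNorm (fun k => (V k).memLp_val T)
    (fun k => (V' k).memLp_val T) (memLp_of_tendsto_eLpNorm (fun k => (V k).memLp_val T) hu hV)
    (memLp_of_tendsto_eLpNorm (fun k => (V' k).memLp_val T) hu' hV') hV hV'
  simp_rw [SimpleAdapted.integral_integral_mul_integral hW] at h1
  exact tendsto_nhds_unique h1 h2

lemma ae_eq (hW : IsFiltrationBrownian ℱ W Q) (h : IsItoIntegral ℱ W Q T u J)
    (h' : IsItoIntegral ℱ W Q T u J') :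
    J =ᵐ[Q] J' := by
  have hm := h.2.1
  have hm' := h'.2.1
  have h0 : ∫ ω, (J ω - J' ω) ^ 2 ∂Q = 0 := by
    have e : ∀ ω, (J ω - J' ω) ^ 2 = J ω * J ω - 2 * (J ω * J' ω) + J' ω * J' ω := fun ω => by ring
    simp_rw [e]
    have i1 : Integrable (fun ω => J ω * J ω) Q := hm.integrable_mul hm
    have i2 : Integrable (fun ω => 2 * (J ω * J' ω)) Q := (hm.integrable_mul hm').const_mul 2
    have i3 : Integrable (fun ω => J' ω * J' ω) Q := hm'.integrable_mul hm'
    rw [integral_add (f := fun ω => _ - _) (i1.sub i2) i3, integral_sub i1 i2, integral_const_mul,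
      h.integral_mul hW h, h.integral_mul hW h', h'.integral_mul hW h']
    ring
  have hsq : Integrable (fun ω => (J ω - J' ω) ^ 2) Q := (hm.sub hm').integrable_sq
  rw [integral_eq_zero_iff_of_nonneg (fun ω => sq_nonneg _) hsq] at h0
  filter_upwards [h0] with ω hω
  exact sub_eq_zero.1 (pow_eq_zero_iff two_ne_zero |>.1 hω)

end IsItoIntegral

/-! ### Integrals of deterministic functions -/

namespace SimpleAdapted

/-- The integrand is a step function of time alone. -/
def IsDeterministic (V : SimpleAdapted ℱ) : Prop := ∀ i, ∃ c : ℝ, ∀ ω, V.ξ i ω = c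

/-- The deterministic step function that equals `g (i δ)` on `(i δ, (i + 1) δ]` for `i < N`. -/
def ofGrid (ℱ : Filtration ℝ≥0 mΩ) (g : ℝ → ℝ) {C : ℝ} (hC : ∀ x, |g x| ≤ C) (δ : ℝ≥0) (N : ℕ) :
    SimpleAdapted ℱ where
  n := N
  part i := i * δ
  mono i j hij := by
    dsimp only
    gcongr
  ξ i _ := g (i * δ)
  meas _ := measurable_const
  bdd := ⟨C, fun _ _ => hC _⟩

lemma ofGrid_val {g : ℝ → ℝ} {C : ℝ} (hC : ∀ x, |g x| ≤ C) {δ : ℝ≥0} {N : ℕ} {j : ℕ} (hj : j < N)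
    {t : ℝ} (ht : t ∈ Ioc (j * δ : ℝ) ((j + 1) * δ)) (ω : Ω) :
    (ofGrid ℱ g hC δ N).val t ω = g (j * δ) := by
  have hmono : Monotone fun i : ℕ => (i * δ : ℝ) := fun i k hik => by
    have := δ.coe_nonneg
    dsimp only
    gcongr
  simp only [val, ofGrid, NNReal.coe_mul, NNReal.coe_natCast, Nat.cast_add, Nat.cast_one,
    NNReal.coe_add, NNReal.coe_one]
  rw [Finset.sum_eq_single_of_mem j (Finset.mem_range.2 hj), indicator_of_mem ht]
  intro i _ hij
  refine indicator_of_notMem (fun hi => ?_) _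
  have hd : Disjoint (Ioc (i * δ : ℝ) ((i + 1 : ℕ) * δ)) (Ioc (j * δ : ℝ) ((j + 1 : ℕ) * δ)) :=
    hmono.pairwise_disjoint_on_Ioc_succ hij
  push_cast at hd
  exact Set.disjoint_left.1 hd hi ht

/-- Deterministic step functions are dense in `L²([0,T])`. -/
lemma exists_isDeterministic_eLpNorm_le [IsProbabilityMeasure Q] (ℱ : Filtration ℝ≥0 mΩ) {T : ℝ≥0}
    {f : ℝ → ℝ} (hf : MemLp f 2 (volume.restrict (Ioc 0 (T : ℝ)))) {ε : ℝ≥0} (hε : 0 < ε) :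
    ∃ V : SimpleAdapted ℱ, V.IsDeterministic ∧
      eLpNorm (fun p : ℝ × Ω => V.val p.1 p.2 - f p.1) 2
        ((volume.restrict (Ioc 0 (T : ℝ))).prod Q) ≤ ε * (T : ℝ≥0∞) ^ (2⁻¹ : ℝ) + ε := by
  obtain ⟨g, hgs, hgf, hgc, hg2⟩ := hf.exists_hasCompactSupport_eLpNorm_sub_le
    ENNReal.ofNat_ne_top (ENNReal.coe_ne_zero.2 hε.ne')
  obtain ⟨C, hC⟩ := hgc.bounded_above_of_compact_support hgs
  obtain ⟨δ, hδ, hgδ⟩ := Metric.uniformContinuous_iff.1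
    (hgs.uniformContinuous_of_continuous hgc) ε (by exact_mod_cast hε)
  obtain ⟨d, hd0, hdδ⟩ : ∃ d : ℝ≥0, (0 : ℝ) < d ∧ (d : ℝ) < δ :=
    ⟨⟨δ / 2, by positivity⟩, half_pos hδ, half_lt_self hδ⟩
  set V := ofGrid ℱ g hC d ⌈(T : ℝ) / d⌉₊
  have hmp : MeasurePreserving Prod.fst ((volume.restrict (Ioc 0 (T : ℝ))).prod Q)
    (volume.restrict (Ioc 0 (T : ℝ))) := measurePreserving_fst
  have hVg : ∀ t ∈ Ioc 0 (T : ℝ), ∀ ω, ‖V.val t ω - g t‖ ≤ ε := by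
    intro t ht ω
    have hc : 0 < ⌈t / d⌉₊ := Nat.ceil_pos.2 (div_pos ht.1 hd0)
    obtain ⟨j, hj⟩ := Nat.exists_eq_add_one.2 hc
    have hjt : t ∈ Ioc (j * d : ℝ) ((j + 1) * d) := by
      constructor
      · rw [← lt_div_iff₀ hd0, ← Nat.lt_ceil, hj]
        exact j.lt_succ_self
      · rw [← div_le_iff₀ hd0]
        exact_mod_cast hj ▸ Nat.le_ceil (t / d)
    have hjN : j < ⌈(T : ℝ) / d⌉₊ := by
      have : ⌈t / d⌉₊ ≤ ⌈(T : ℝ) / d⌉₊ := Nat.ceil_mono (by gcongr; exact ht.2)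
      omega
    rw [ofGrid_val hC hjN hjt, ← dist_eq_norm]
    refine (hgδ ?_).le
    rw [Real.dist_eq, abs_sub_comm, abs_of_nonneg (sub_nonneg.2 hjt.1.le)]
    linarith [hjt.2]
  refine ⟨V, fun i => ⟨_, fun _ => rfl⟩, ?_⟩
  have hsplit : (fun p : ℝ × Ω => V.val p.1 p.2 - f p.1)
      = (fun p : ℝ × Ω => V.val p.1 p.2 - g p.1) + (g - f) ∘ Prod.fst := by
    ext p
    simp
  have hgm : MemLp (g ∘ Prod.fst) 2 ((volume.restrict (Ioc 0 (T : ℝ))).prod Q) :=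
    hg2.comp_measurePreserving hmp
  rw [hsplit]
  refine (eLpNorm_add_le ((V.memLp_val T).1.sub hgm.1)
    ((hg2.sub hf).comp_measurePreserving hmp).1 one_le_two).trans (add_le_add ?_ ?_)
  · refine (eLpNorm_le_of_ae_bound (C := ε) ?_).trans ?_
    · filter_upwards [hmp.quasiMeasurePreserving.ae (ae_restrict_mem measurableSet_Ioc)] with p hp
      exact hVg p.1 hp p.2
    · rw [← univ_prod_univ, Measure.prod_prod]
      simp [mul_comm, ENNReal.ofReal_coe_nnreal]
  · rw [eLpNorm_comp_measurePreserving (hg2.sub hf).1 hmp, eLpNorm_sub_comm]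
    exact hgf

lemma IsDeterministic.integral_mem_span {V : SimpleAdapted ℱ} (hV : V.IsDeterministic)
    (W : ℝ≥0 → Ω → ℝ) (T : ℝ≥0) : V.integral W T ∈ Submodule.span ℝ (range W) := by
  choose c hc using hV
  have h : V.integral W T = ∑ i ∈ Finset.range V.n,
      c i • (W (min (V.part (i + 1)) T) - W (min (V.part i) T)) := by
    ext ω
    simp [SimpleAdapted.integral, hc]
  rw [h]
  exact Submodule.sum_mem _ fun i _ => Submodule.smul_mem _ _ (Submodule.sub_mem _
    (Submodule.subset_span (mem_range_self _)) (Submodule.subset_span (mem_range_self _)))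

end SimpleAdapted

lemma hasGaussianLaw_of_mem_span (hW : IsGaussianProcess W Q) {X : Ω → ℝ}
    (hX : X ∈ Submodule.span ℝ (range W)) : HasGaussianLaw X Q := by
  obtain ⟨c, rfl⟩ := Finsupp.mem_span_range_iff_exists_finsupp.1 hX
  have h := (hW.smul (fun t => c t)).hasGaussianLaw_sum (I := c.support)
  exact h

lemma integral_eq_zero_of_mem_span (hW : IsFiltrationBrownian ℱ W Q) {X : Ω → ℝ}
    (hX : X ∈ Submodule.span ℝ (range W)) : ∫ ω, X ω ∂Q = 0 := by
  obtain ⟨c, rfl⟩ := Finsupp.mem_span_range_iff_exists_finsupp.1 hX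
  simp only [Finsupp.sum, Finset.sum_apply, Pi.smul_apply, smul_eq_mul]
  rw [integral_finsetSum _ fun t _ => (hW.integrable_eval t).const_mul _]
  simp [integral_const_mul, hW.integral_eval]

lemma measurable_comap_of_mem_span {X : Ω → ℝ} (hX : X ∈ Submodule.span ℝ (range W)) :
    Measurable[MeasurableSpace.comap (fun ω t => W t ω) inferInstance] X := by
  obtain ⟨c, rfl⟩ := Finsupp.mem_span_range_iff_exists_finsupp.1 hX
  have e : (c.sum fun t a => a • W t) = fun ω => ∑ t ∈ c.support, c t * W t ω := by
    ext ω
    simp [Finsupp.sum]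
  have h : ∀ t, Measurable[MeasurableSpace.comap (fun ω t => W t ω) inferInstance] (W t) :=
    fun t => (measurable_pi_apply t).comp (comap_measurable fun ω t => W t ω)
  rw [e]
  exact Finset.measurable_sum _ fun t _ => (h t).const_mul (c t)

/-- Real Gaussian variables are closed under convergence in `L²`. -/
lemma hasGaussianLaw_of_tendsto_eLpNorm [IsProbabilityMeasure Q] {X : ℕ → Ω → ℝ} {Y : Ω → ℝ}
    (hX : ∀ k, HasGaussianLaw (X k) Q) (hY : MemLp Y 2 Q)
    (hXY : Tendsto (fun k => eLpNorm (fun ω => X k ω - Y ω) 2 Q) atTop (𝓝 0)) :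
    HasGaussianLaw Y Q := by
  have hX2 : ∀ k, MemLp (X k) 2 Q := fun k => (hX k).memLp_two
  have hm : Tendsto (fun k => ∫ ω, X k ω ∂Q) atTop (𝓝 (∫ ω, Y ω ∂Q)) := by
    have h := tendsto_integral_mul_of_tendsto_eLpNorm (g := fun _ _ => (1 : ℝ)) (g' := fun _ => 1)
      hX2 (fun _ => memLp_const 1) hY (memLp_const 1) hXY (by simp)
    simpa using h
  have hv : Tendsto (fun k => Var[X k; Q]) atTop (𝓝 Var[Y; Q]) := by
    have h := (tendsto_integral_mul_of_tendsto_eLpNorm hX2 hX2 hY hY hXY hXY).sub (hm.pow 2)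
    rw [variance_eq_sub hY]
    simp_rw [fun k => variance_eq_sub (hX2 k)]
    simpa only [Pi.pow_apply, sq] using h
  have hd : TendstoInDistribution X atTop Y (fun _ => Q) Q :=
    (tendstoInMeasure_of_tendsto_eLpNorm two_ne_zero (fun k => (hX2 k).1) hY.1
      hXY).tendstoInDistribution fun k => (hX k).aemeasurable
  rw [hasGaussianLaw_iff_charFun_map_eq hY.aemeasurable]
  intro t
  have hc := ProbabilityMeasure.tendsto_iff_tendsto_charFun.1 hd.tendsto t
  refine tendsto_nhds_unique hc ?_
  simp only [ProbabilityMeasure.coe_mk, fun k => (hX k).charFun_map_eq, Real.inner_apply,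
    integral_mul_const, variance_mul_const, mul_comm t]
  refine (Complex.continuous_exp.tendsto _).comp (Tendsto.sub ?_ ?_)
  · exact ((Complex.continuous_ofReal.tendsto _).comp (hm.mul_const _)).mul_const _
  · exact ((Complex.continuous_ofReal.tendsto _).comp (hv.mul_const _)).div_const _

/-- Deterministic square integrable functions are Itô integrable. -/
lemma exists_isItoIntegral_deterministic (hW : IsFiltrationBrownian ℱ W Q) {T : ℝ≥0} {f : ℝ → ℝ}
    (hf : MemLp f 2 (volume.restrict (Ioc 0 (T : ℝ)))) :
    ∃ J : Ω → ℝ, IsItoIntegral ℱ W Q T (fun t _ => f t) J ∧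
      ∃ V : ℕ → SimpleAdapted ℱ, (∀ k, (V k).IsDeterministic) ∧
        Tendsto (fun k => eLpNorm (fun ω => (V k).integral W T ω - J ω) 2 Q) atTop (𝓝 0) := by
  have : IsProbabilityMeasure Q := hW.isProbabilityMeasure
  choose V hVd hV using fun k : ℕ => SimpleAdapted.exists_isDeterministic_eLpNorm_le (Q := Q) ℱ hf
    (ε := 1 / ((k : ℝ≥0) + 1)) (by positivity)
  have hfm : MemLp (fun p : ℝ × Ω => f p.1) 2 ((volume.restrict (Ioc 0 (T : ℝ))).prod Q) :=
    hf.comp_fst Q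
  have hVt : Tendsto (fun k => eLpNorm (fun p : ℝ × Ω => (V k).val p.1 p.2 - f p.1) 2
      ((volume.restrict (Ioc 0 (T : ℝ))).prod Q)) atTop (𝓝 0) := by
    refine tendsto_of_tendsto_of_tendsto_of_le_of_le tendsto_const_nhds ?_ (fun _ => zero_le) hV
    have h0 : Tendsto (fun k : ℕ => ((1 / ((k : ℝ≥0) + 1) : ℝ≥0) : ℝ≥0∞)) atTop (𝓝 0) :=
      ENNReal.tendsto_coe.2 tendsto_one_div_add_atTop_nhds_zero_nat
    have hT : (T : ℝ≥0∞) ^ (2⁻¹ : ℝ) ≠ ∞ := ENNReal.rpow_ne_top_of_nonneg (by norm_num)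
      ENNReal.coe_ne_top
    simpa using (ENNReal.Tendsto.mul_const h0 (Or.inr hT)).add h0
  have hVL := (Lp.tendsto_Lp_iff_tendsto_eLpNorm'' (fun k => fun p : ℝ × Ω => (V k).val p.1 p.2)
    (fun k => (V k).memLp_val T) _ hfm).2 hVt
  -- By the isometry the elementary integrals are as close to each other as the integrands.
  have hdist : ∀ k l, dist (((V k).memLp_integral hW T).toLp _) (((V l).memLp_integral hW T).toLp _)
      = dist (((V k).memLp_val (Q := Q) T).toLp _) (((V l).memLp_val (Q := Q) T).toLp _) := by
    intro k l
    rw [dist_eq_norm, dist_eq_norm, ← sq_eq_sq₀ (norm_nonneg _) (norm_nonneg _),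
      norm_sub_sq_real, norm_sub_sq_real, ← real_inner_self_eq_norm_sq,
      ← real_inner_self_eq_norm_sq, ← real_inner_self_eq_norm_sq, ← real_inner_self_eq_norm_sq]
    simp only [inner_toLp_toLp, SimpleAdapted.integral_integral_mul_integral hW]
  have hcau : CauchySeq fun k => ((V k).memLp_integral hW T).toLp ((V k).integral W T) := by
    have h := hVL.cauchySeq
    rw [Metric.cauchySeq_iff] at h ⊢
    simpa only [hdist] using h
  obtain ⟨J, hJ⟩ := cauchySeq_tendsto_of_complete hcau
  rw [← Lp.toLp_coeFn J (Lp.memLp J), Lp.tendsto_Lp_iff_tendsto_eLpNorm''] at hJ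
  exact ⟨J, ⟨hfm.1, Lp.memLp J, V, hVt, hJ⟩, V, hVd, hJ⟩

namespace IsItoIntegral

variable {T : ℝ≥0} {f f' : ℝ → ℝ} {J J' : Ω → ℝ}

/-- The integral of a deterministic function is a limit of integrals of deterministic step
functions, although the approximating processes in `IsItoIntegral` may be random. -/
lemma exists_isDeterministic (hW : IsFiltrationBrownian ℱ W Q)
    (hf : MemLp f 2 (volume.restrict (Ioc 0 (T : ℝ))))
    (h : IsItoIntegral ℱ W Q T (fun t _ => f t) J) :
    ∃ V : ℕ → SimpleAdapted ℱ, (∀ k, (V k).IsDeterministic) ∧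
      Tendsto (fun k => eLpNorm (fun ω => (V k).integral W T ω - J ω) 2 Q) atTop (𝓝 0) := by
  obtain ⟨J', hJ', V, hV, ht⟩ := exists_isItoIntegral_deterministic hW hf
  refine ⟨V, hV, ht.congr fun k => eLpNorm_congr_ae ?_⟩
  filter_upwards [h.ae_eq hW hJ'] with ω hω
  rw [hω]

/-- Up to a null set the integral of a deterministic function is a functional of the path of `W`,
which is how independence of Brownian motions passes to their integrals. -/
lemma aestronglyMeasurable_comap (hW : IsFiltrationBrownian ℱ W Q)
    (hf : MemLp f 2 (volume.restrict (Ioc 0 (T : ℝ))))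
    (h : IsItoIntegral ℱ W Q T (fun t _ => f t) J) :
    AEStronglyMeasurable[MeasurableSpace.comap (fun ω t => W t ω) inferInstance] J Q := by
  obtain ⟨V, hV, ht⟩ := h.exists_isDeterministic hW hf
  have hle : MeasurableSpace.comap (fun ω t => W t ω) inferInstance ≤ mΩ :=
    (measurable_pi_lambda _ fun t => (hW.adapted t).mono (ℱ.le t) le_rfl).comap_le
  have hL := (Lp.tendsto_Lp_iff_tendsto_eLpNorm'' _ (fun k => (V k).memLp_integral hW T) J h.2.1).2
    ht
  have hmem := (isClosed_aestronglyMeasurable (F := ℝ) (p := 2) (μ := Q) hle).mem_of_tendsto hL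
    (Eventually.of_forall fun k => ?_)
  · exact AEStronglyMeasurable.congr hmem h.2.1.coeFn_toLp
  · exact (measurable_comap_of_mem_span
      ((hV k).integral_mem_span W T)).stronglyMeasurable.aestronglyMeasurable.congr
      ((V k).memLp_integral hW T).coeFn_toLp.symm

lemma integral_eq_zero (hW : IsFiltrationBrownian ℱ W Q)
    (hf : MemLp f 2 (volume.restrict (Ioc 0 (T : ℝ))))
    (h : IsItoIntegral ℱ W Q T (fun t _ => f t) J) : ∫ ω, J ω ∂Q = 0 := by
  have : IsProbabilityMeasure Q := hW.isProbabilityMeasure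
  obtain ⟨V, hV, ht⟩ := h.exists_isDeterministic hW hf
  have hl := tendsto_integral_mul_of_tendsto_eLpNorm (g := fun _ _ => (1 : ℝ)) (g' := fun _ => 1)
    (fun k => (V k).memLp_integral hW T) (fun _ => memLp_const 1) h.2.1 (memLp_const 1) ht (by simp)
  simp only [mul_one,
    fun k => integral_eq_zero_of_mem_span hW ((hV k).integral_mem_span W T)] at hl
  exact tendsto_nhds_unique hl tendsto_const_nhds

/-- Integrals of two deterministic functions are jointly Gaussian. -/
lemma hasGaussianLaw_prodMk (hW : IsFiltrationBrownian ℱ W Q)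
    (hf : MemLp f 2 (volume.restrict (Ioc 0 (T : ℝ))))
    (hf' : MemLp f' 2 (volume.restrict (Ioc 0 (T : ℝ))))
    (h : IsItoIntegral ℱ W Q T (fun t _ => f t) J)
    (h' : IsItoIntegral ℱ W Q T (fun t _ => f' t) J') :
    HasGaussianLaw (fun ω => (J ω, J' ω)) Q := by
  have : IsProbabilityMeasure Q := hW.isProbabilityMeasure
  obtain ⟨V, hV, ht⟩ := h.exists_isDeterministic hW hf
  obtain ⟨V', hV', ht'⟩ := h'.exists_isDeterministic hW hf'
  have hlin : ∀ a b : ℝ, HasGaussianLaw (fun ω => a * J ω + b * J' ω) Q := by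
    intro a b
    have hm : MemLp (fun ω => a * J ω + b * J' ω) 2 Q :=
      (h.2.1.const_mul a).add (h'.2.1.const_mul b)
    have hk : ∀ k, a • (V k).integral W T + b • (V' k).integral W T
        ∈ Submodule.span ℝ (range W) := fun k =>
      Submodule.add_mem _ (Submodule.smul_mem _ _ ((hV k).integral_mem_span W T))
        (Submodule.smul_mem _ _ ((hV' k).integral_mem_span W T))
    refine hasGaussianLaw_of_tendsto_eLpNorm
      (fun k => hasGaussianLaw_of_mem_span hW.isGaussianProcess (hk k)) hm ?_
    have hL := (Lp.tendsto_Lp_iff_tendsto_eLpNorm'' _ (fun k => (V k).memLp_integral hW T) J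
      h.2.1).2 ht
    have hL' := (Lp.tendsto_Lp_iff_tendsto_eLpNorm'' _ (fun k => (V' k).memLp_integral hW T) J'
      h'.2.1).2 ht'
    exact (Lp.tendsto_Lp_iff_tendsto_eLpNorm'' _ (fun k =>
      (((V k).memLp_integral hW T).const_smul a).add (((V' k).memLp_integral hW T).const_smul b))
      _ ((h.2.1.const_smul a).add (h'.2.1.const_smul b))).1
      ((hL.const_smul a).add (hL'.const_smul b))
  have hmeas : AEMeasurable (fun ω => (J ω, J' ω)) Q :=
    h.2.1.aemeasurable.prodMk h'.2.1.aemeasurable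
  rw [hasGaussianLaw_iff_charFunDual_map_eq hmeas]
  intro L
  have hL : ∀ ω, L (J ω, J' ω) = L (1, 0) * J ω + L (0, 1) * J' ω := fun ω => by
    have e : ((J ω, J' ω) : ℝ × ℝ) = J ω • (1, 0) + J' ω • (0, 1) := by simp
    rw [e, map_add, map_smul, map_smul, smul_eq_mul, smul_eq_mul, mul_comm, mul_comm (J' ω)]
  have hg := (hlin (L (1, 0)) (L (0, 1))).charFun_map_eq 1
  simp only [← hL] at hg
  rw [charFunDual_eq_charFun_map_one, AEMeasurable.map_map_of_aemeasurable (by fun_prop) hmeas]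
  simpa [Function.comp_def] using hg

end IsItoIntegral

/-- Almost sure modifications of variables measurable with respect to independent σ-algebras are
independent. -/
lemma indepFun_of_aestronglyMeasurable {m₁ m₂ : MeasurableSpace Ω} (h : Indep m₁ m₂ Q)
    {E F : Type*} [TopologicalSpace E] [MeasurableSpace E] [BorelSpace E]
    [TopologicalSpace.PseudoMetrizableSpace E] [TopologicalSpace F] [MeasurableSpace F]
    [BorelSpace F] [TopologicalSpace.PseudoMetrizableSpace F] {X : Ω → E} {Y : Ω → F}
    (hX : AEStronglyMeasurable[m₁] X Q) (hY : AEStronglyMeasurable[m₂] Y Q) : IndepFun X Y Q := by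
  have h' : IndepFun (hX.mk X) (hY.mk Y) Q := by
    rw [IndepFun_iff_Indep]
    exact indep_of_indep_of_le_left (indep_of_indep_of_le_right h
      hY.stronglyMeasurable_mk.measurable.comap_le) hX.stronglyMeasurable_mk.measurable.comap_le
  exact h'.congr hX.ae_eq_mk.symm hY.ae_eq_mk.symm

/-! ### Translations of a Gaussian law -/

/-- Exponential tilting translates a centred Gaussian law. -/
lemma tilted_mul_gaussianReal {v : ℝ≥0} (hv : v ≠ 0) (s : ℝ) :
    (gaussianReal 0 v).tilted (fun x => s * x) = gaussianReal (v * s) v := by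
  have hm : ∫ x, Real.exp (s * x) ∂(gaussianReal 0 v) = Real.exp (v * s ^ 2 / 2) := by
    have h := congrFun (mgf_fun_id_gaussianReal (μ := 0) (v := v)) s
    simpa [mgf] using h
  have hv' : (v : ℝ) ≠ 0 := by exact_mod_cast hv
  rw [Measure.tilted, hm, gaussianReal_of_var_ne_zero _ hv, gaussianReal_of_var_ne_zero _ hv,
    ← withDensity_mul _ (measurable_gaussianPDF 0 v) (by fun_prop)]
  congr 1
  ext x
  rw [Pi.mul_apply, gaussianPDF, gaussianPDF, ← ENNReal.ofReal_mul (gaussianPDFReal_nonneg _ _ _)]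
  congr 1
  rw [gaussianPDFReal, gaussianPDFReal, mul_assoc, ← Real.exp_sub, ← Real.exp_add]
  congr 2
  field_simp
  ring

lemma memLp_exp_mul_gaussianReal (v : ℝ≥0) (s : ℝ) :
    MemLp (fun x => Real.exp (s * x)) 2 (gaussianReal 0 v) := by
  rw [memLp_two_iff_integrable_sq (by fun_prop)]
  refine (integrable_exp_mul_gaussianReal (2 * s)).congr (ae_of_all _ fun x => ?_)
  dsimp only
  rw [← Real.exp_nat_mul]
  congr 1
  push_cast
  ring

lemma integrable_comp_add_gaussianReal {v : ℝ≥0} (hv : v ≠ 0) {G : ℝ → ℝ} (hGm : Measurable G)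
    (hG : MemLp G 2 (gaussianReal 0 v)) (θ : ℝ) :
    Integrable (fun x => G (x + θ)) (gaussianReal 0 v) := by
  have hθ : (v : ℝ) * (θ / v) = θ := mul_div_cancel₀ _ (by exact_mod_cast hv)
  have h : Integrable G (gaussianReal θ v) := by
    rw [← hθ, ← tilted_mul_gaussianReal hv, integrable_tilted_iff
      (integrable_exp_mul_gaussianReal _)]
    exact (memLp_exp_mul_gaussianReal v (θ / v)).integrable_mul hG
  have hmap := gaussianReal_map_add_const (μ := 0) (v := v) θ
  rw [zero_add] at hmap
  rw [← hmap, integrable_map_measure hGm.aestronglyMeasurable (by fun_prop)] at h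
  exact h

/-- The Cameron–Martin formula for a one-dimensional Gaussian law. -/
lemma integral_comp_add_gaussianReal {v : ℝ≥0} (hv : v ≠ 0) {G : ℝ → ℝ} (hGm : Measurable G)
    (θ : ℝ) :
    ∫ x, G (x + θ) ∂(gaussianReal 0 v)
      = Real.exp (-(θ ^ 2 / (2 * v))) * ∫ x, G x * Real.exp (θ / v * x) ∂(gaussianReal 0 v) := by
  have hv' : (v : ℝ) ≠ 0 := by exact_mod_cast hv
  have hθ : (v : ℝ) * (θ / v) = θ := mul_div_cancel₀ _ hv'
  have hmap := gaussianReal_map_add_const (μ := 0) (v := v) θ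
  rw [zero_add] at hmap
  have hm : ∫ x, Real.exp (θ / v * x) ∂(gaussianReal 0 v) = Real.exp (θ ^ 2 / (2 * v)) := by
    have h := congrFun (mgf_fun_id_gaussianReal (μ := 0) (v := v)) (θ / v)
    simp only [mgf] at h
    rw [h]
    congr 1
    field_simp
    ring
  rw [← integral_map (φ := fun x => x + θ) (f := G) (by fun_prop) hGm.aestronglyMeasurable, hmap]
  conv_lhs => rw [← hθ, ← tilted_mul_gaussianReal hv, integral_tilted, hm]
  rw [← integral_const_mul]
  refine integral_congr_ae (ae_of_all _ fun x => ?_)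
  simp only [smul_eq_mul, Real.exp_neg]
  ring

/-- Gaussian smoothing: the expectation is differentiable in the translation even though `G` is
only measurable, since the Cameron–Martin formula moves the translation to the smooth density. -/
lemma hasDerivAt_integral_comp_add_gaussianReal {v : ℝ≥0} (hv : v ≠ 0) {G : ℝ → ℝ}
    (hGm : Measurable G) (hG : MemLp G 2 (gaussianReal 0 v)) :
    HasDerivAt (fun θ => ∫ x, G (x + θ) ∂(gaussianReal 0 v))
      ((∫ x, G x * x ∂(gaussianReal 0 v)) / v) 0 := by
  have hv' : (v : ℝ) ≠ 0 := by exact_mod_cast hv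
  have hbound : Integrable (fun x => |G x| * (Real.exp (2 * x) + Real.exp (-2 * x)))
      (gaussianReal 0 v) :=
    hG.abs.integrable_mul
      ((memLp_exp_mul_gaussianReal v 2).add (memLp_exp_mul_gaussianReal v (-2)))
  have hd := (hasDerivAt_integral_of_dominated_loc_of_deriv_le (μ := gaussianReal 0 v)
    (F := fun s x => G x * Real.exp (s * x)) (F' := fun s x => G x * (x * Real.exp (s * x)))
    (x₀ := (0 : ℝ)) (s := Metric.ball 0 1)
    (Metric.ball_mem_nhds _ one_pos) (Eventually.of_forall fun s => by fun_prop)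
    (by simpa using hG.integrable one_le_two) (by fun_prop) (ae_of_all _ fun x s hs => ?_) hbound
    (ae_of_all _ fun x s _ => ?_)).2
  · have h1 : HasDerivAt (fun θ : ℝ => Real.exp (-(θ ^ 2 / (2 * v)))) 0 0 := by
      have h : HasDerivAt (fun θ : ℝ => -(θ ^ 2 / (2 * (v : ℝ)))) 0 0 := by
        simpa using ((hasDerivAt_pow 2 (0 : ℝ)).div_const (2 * (v : ℝ))).fun_neg
      simpa using h.exp
    have h2 : HasDerivAt (fun θ : ℝ => θ / (v : ℝ)) (1 / v) 0 := (hasDerivAt_id 0).div_const _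
    have h3 := h1.mul (hd.comp_of_eq 0 h2 (zero_div _).symm)
    have h4 : (fun θ => ∫ x, G (x + θ) ∂(gaussianReal 0 v)) = fun θ : ℝ =>
        Real.exp (-(θ ^ 2 / (2 * v))) *
          ∫ x, G x * Real.exp (θ / v * x) ∂(gaussianReal 0 v) :=
      funext fun θ => integral_comp_add_gaussianReal hv hGm θ
    rw [h4]
    refine h3.congr_deriv ?_
    simp [div_eq_mul_inv]
  · -- `|x| ≤ exp |x|` and `|s| < 1` bound the derivative by `|G x| exp (2 |x|)`.
    have hs1 : |s| < 1 := by simpa using hs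
    have hx : |x| ≤ Real.exp |x| := by linarith [Real.add_one_le_exp |x|]
    have hsx : s * x ≤ |x| := (le_abs_self _).trans
      (by rw [abs_mul]; exact mul_le_of_le_one_left (abs_nonneg _) hs1.le)
    have h2 : Real.exp (2 * |x|) ≤ Real.exp (2 * x) + Real.exp (-2 * x) := by
      rcases abs_cases x with ⟨h, _⟩ | ⟨h, _⟩ <;> rw [h]
      · linarith [Real.exp_pos (-2 * x)]
      · rw [mul_neg, ← neg_mul]
        linarith [Real.exp_pos (2 * x)]
    rw [Real.norm_eq_abs, abs_mul, abs_mul, Real.abs_exp]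
    gcongr
    calc |x| * Real.exp (s * x) ≤ Real.exp |x| * Real.exp |x| := by gcongr
      _ = Real.exp (2 * |x|) := by rw [← Real.exp_add, two_mul]
      _ ≤ _ := h2
  · have h : HasDerivAt (fun s : ℝ => s * x) x s := by simpa using (hasDerivAt_id s).mul_const x
    refine (h.exp.const_mul (G x)).congr_deriv ?_
    ring

/-- Gaussian regression: a functional of `X` sees a jointly Gaussian variable `B` only through its
projection on `X`. -/
lemma integral_comp_mul_of_hasGaussianLaw
    {X B : Ω → ℝ} (hXB : HasGaussianLaw (fun ω => (X ω, B ω)) Q) (hX0 : ∫ ω, X ω ∂Q = 0)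
    (hB0 : ∫ ω, B ω ∂Q = 0) (hXX : ∫ ω, X ω * X ω ∂Q ≠ 0) {G : ℝ → ℝ} (hGm : Measurable G)
    (hG : MemLp (fun ω => G (X ω)) 2 Q) :
    ∫ ω, G (X ω) * B ω ∂Q
      = (∫ ω, X ω * B ω ∂Q) / (∫ ω, X ω * X ω ∂Q) * ∫ ω, G (X ω) * X ω ∂Q := by
  have : IsProbabilityMeasure Q := hXB.isProbabilityMeasure
  have hX := hXB.fst.memLp_two
  have hB := hXB.snd.memLp_two
  set c := (∫ ω, X ω * B ω ∂Q) / (∫ ω, X ω * X ω ∂Q) with hc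
  have hR : MemLp (fun ω => B ω - c * X ω) 2 Q := hB.sub (hX.const_mul c)
  have hR0 : ∫ ω, B ω - c * X ω ∂Q = 0 := by
    rw [integral_sub (hB.integrable one_le_two) ((hX.integrable one_le_two).const_mul c),
      integral_const_mul, hX0, hB0, mul_zero, sub_zero]
  have hXR : HasGaussianLaw (fun ω => (X ω, B ω - c * X ω)) Q :=
    hXB.map_fun ((ContinuousLinearMap.fst ℝ ℝ ℝ).prod
      (ContinuousLinearMap.snd ℝ ℝ ℝ - c • ContinuousLinearMap.fst ℝ ℝ ℝ))
  have iXB : Integrable (fun ω => X ω * B ω) Q := hX.integrable_mul hB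
  have iXX : Integrable (fun ω => X ω * X ω) Q := hX.integrable_mul hX
  have hind : IndepFun X (fun ω => B ω - c * X ω) Q := by
    refine hXR.indepFun_of_covariance_eq_zero ?_
    rw [covariance_eq_sub hX hR, hX0, zero_mul, sub_zero]
    have e : ∀ ω, (X * fun ω => B ω - c * X ω) ω = X ω * B ω - c * (X ω * X ω) := fun ω => by
      simp only [Pi.mul_apply]
      ring
    simp_rw [e]
    rw [integral_sub iXB (iXX.const_mul c), integral_const_mul, hc, div_mul_cancel₀ _ hXX, sub_self]
  have h0 : ∫ ω, G (X ω) * (B ω - c * X ω) ∂Q = 0 := by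
    have h := (hind.comp hGm measurable_id).integral_fun_mul_eq_mul_integral hG.1 hR.1
    simpa [hR0] using h
  have iGB : Integrable (fun ω => G (X ω) * B ω) Q := hG.integrable_mul hB
  have iGX : Integrable (fun ω => G (X ω) * X ω) Q := hG.integrable_mul hX
  have e : ∀ ω, G (X ω) * (B ω - c * X ω) = G (X ω) * B ω - c * (G (X ω) * X ω) := fun ω => by ring
  simp_rw [e] at h0
  rw [integral_sub iGB (iGX.const_mul c), integral_const_mul] at h0
  exact sub_eq_zero.1 h0

/-! ### The futures price and the delta weight -/

lemma isItoIntegral_itoIntegral {T : ℝ≥0} {u : ℝ → Ω → ℝ} (h : ItoIntegrable ℱ W Q T u) :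
    IsItoIntegral ℱ W Q T u (itoIntegral ℱ W Q T u) := by
  rw [itoIntegral, dif_pos h]
  exact h.choose_spec

lemma itoIntegrable_deterministic (hW : IsFiltrationBrownian ℱ W Q) {T : ℝ≥0} {f : ℝ → ℝ}
    (hf : MemLp f 2 (volume.restrict (Ioc 0 (T : ℝ)))) :
    ItoIntegrable ℱ W Q T (fun t _ => f t) :=
  let ⟨J, hJ, _⟩ := exists_isItoIntegral_deterministic hW hf
  ⟨J, hJ⟩

/-- The stochastic exponential cancels in the integrand of the weight, which is deterministic. -/
lemma deltaIntegrand_eq (σ a : ℝ → ℝ) (x : ℝ) :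
    deltaIntegrand ℱ W Q σ x a = fun t _ => a t * (σ t * x)⁻¹ := by
  ext t ω
  have h : stochExp ℱ W Q σ t.toNNReal ω ≠ 0 := (Real.exp_pos _).ne'
  rw [deltaIntegrand, futuresPrice, ← mul_assoc (σ t), mul_inv, mul_assoc, inv_mul_cancel₀ h,
    mul_one]

lemma UniformlyElliptic.exists_lt_sq {σ : ℝ → ℝ} {T : ℝ≥0} (h : UniformlyElliptic σ T) :
    ∃ η : ℝ, 0 < η ∧ ∀ t ∈ Icc (0 : ℝ) T, η < σ t ^ 2 := by
  obtain ⟨η, hη, h⟩ := h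
  refine ⟨η, hη, fun t ht => ?_⟩
  have := h t ht 1 one_ne_zero
  simp only [abs_one, one_pow, mul_one, one_mul] at this
  rwa [sq]

lemma UniformlyElliptic.ne_zero {σ : ℝ → ℝ} {T : ℝ≥0} (h : UniformlyElliptic σ T) {t : ℝ}
    (ht : t ∈ Icc (0 : ℝ) T) : σ t ≠ 0 := by
  obtain ⟨η, hη, h⟩ := h.exists_lt_sq
  intro h0
  have := h t ht
  rw [h0] at this
  norm_num at this
  linarith

lemma UniformlyElliptic.memLp_mul_inv {σ a : ℝ → ℝ} {T : ℝ≥0} (h : UniformlyElliptic σ T)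
    (hσ : AEMeasurable σ (volume.restrict (Ioc 0 (T : ℝ)))) {x : ℝ} (hx : 0 < x)
    (ha : MemLp a 2 (volume.restrict (Ioc 0 (T : ℝ)))) :
    MemLp (fun t => a t * (σ t * x)⁻¹) 2 (volume.restrict (Ioc 0 (T : ℝ))) := by
  obtain ⟨η, hη, h⟩ := h.exists_lt_sq
  have hb : MemLp (fun t => (σ t * x)⁻¹) ∞ (volume.restrict (Ioc 0 (T : ℝ))) := by
    refine memLp_top_of_bound (hσ.mul_const x).inv.aestronglyMeasurable (√η * x)⁻¹ ?_
    filter_upwards [ae_restrict_mem measurableSet_Ioc] with t ht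
    rw [norm_inv, Real.norm_eq_abs, abs_mul, abs_of_pos hx]
    have h1 : √η ≤ |σ t| := Real.sqrt_le_iff.2
      ⟨abs_nonneg _, by rw [sq_abs]; exact (h t (Ioc_subset_Icc_self ht)).le⟩
    have h2 : 0 < √η := Real.sqrt_pos.2 hη
    gcongr
  exact hb.mul' ha

lemma UniformlyElliptic.integral_sq_pos {σ : ℝ → ℝ} {T : ℝ≥0} (h : UniformlyElliptic σ T)
    (hσ : MemLp σ 2 (volume.restrict (Ioc 0 (T : ℝ)))) (hT : 0 < T) :
    0 < ∫ t in Ioc 0 (T : ℝ), σ t * σ t := by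
  obtain ⟨η, hη, h⟩ := h.exists_lt_sq
  have h1 : ∫ _ in Ioc 0 (T : ℝ), η ≤ ∫ t in Ioc 0 (T : ℝ), σ t * σ t := by
    refine setIntegral_mono_on (integrable_const _) (hσ.integrable_mul hσ) measurableSet_Ioc
      fun t ht => ?_
    rw [← sq]
    exact (h t (Ioc_subset_Icc_self ht)).le
  refine lt_of_lt_of_le ?_ h1
  have : (0 : ℝ) < T := by exact_mod_cast hT
  simp only [integral_const, measureReal_restrict_apply_univ, Real.volume_real_Ioc, sub_zero,
    smul_eq_mul]
  positivity

/-- The polarized isometry for deterministic integrands. -/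
lemma IsItoIntegral.integral_mul_deterministic (hW : IsFiltrationBrownian ℱ W Q) {T : ℝ≥0}
    {f f' : ℝ → ℝ} {J J' : Ω → ℝ} (h : IsItoIntegral ℱ W Q T (fun t _ => f t) J)
    (h' : IsItoIntegral ℱ W Q T (fun t _ => f' t) J') :
    ∫ ω, J ω * J' ω ∂Q = ∫ t in Ioc 0 (T : ℝ), f t * f' t := by
  have : IsProbabilityMeasure Q := hW.isProbabilityMeasure
  rw [h.integral_mul hW h', integral_fun_fst (fun t => f t * f' t)]
  simp

/-- The price of a claim on `F(T)` as a function of the initial value: it is well defined for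
positive initial values, and its derivative is the Gaussian one, with `X = ∫₀ᵀ σ dW`. -/
lemma integrable_and_hasDerivAt_futuresPrice (hW : IsFiltrationBrownian ℱ W Q) {T : ℝ≥0}
    (hT : 0 < T) {σ : ℝ → ℝ} (hσ : MemLp σ 2 (volume.restrict (Ioc 0 (T : ℝ))))
    (hell : UniformlyElliptic σ T) {x₀ : ℝ} (hx₀ : 0 < x₀) {g : ℝ → ℝ} (hg : Measurable g)
    (hg2 : MemLp (fun ω => g (futuresPrice ℱ W Q σ x₀ T ω)) 2 Q) :
    (∀ x, 0 < x → Integrable (fun ω => g (futuresPrice ℱ W Q σ x T ω)) Q) ∧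
    HasDerivAt (fun x => ∫ ω, g (futuresPrice ℱ W Q σ x T ω) ∂Q)
      ((∫ ω, g (futuresPrice ℱ W Q σ x₀ T ω) * itoIntegral ℱ W Q T (fun t _ => σ t) ω ∂Q)
        / (∫ t in Ioc 0 (T : ℝ), σ t * σ t) / x₀) x₀ := by
  have : IsProbabilityMeasure Q := hW.isProbabilityMeasure
  have hX := isItoIntegral_itoIntegral (itoIntegrable_deterministic hW hσ)
  set X := itoIntegral ℱ W Q T (fun t _ => σ t)
  have hXX := hX.integral_mul_deterministic hW hX
  have hX0 := hX.integral_eq_zero hW hσ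
  have hpos := hell.integral_sq_pos hσ hT
  obtain ⟨v, hv⟩ : ∃ v : ℝ≥0, (v : ℝ) = ∫ t in Ioc 0 (T : ℝ), σ t * σ t := ⟨⟨_, hpos.le⟩, rfl⟩
  have hv0 : v ≠ 0 := fun h => by
    rw [← hv, h] at hpos
    exact lt_irrefl _ hpos
  have hvar : Var[X; Q] = v := by
    rw [variance_of_integral_eq_zero hX.2.1.aemeasurable hX0, hv, ← hXX]
    simp only [sq]
  have hlaw : Q.map X = gaussianReal 0 v := by
    rw [(hX.hasGaussianLaw_prodMk hW hσ hσ hX).fst.map_eq_gaussianReal, hX0, hvar,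
      Real.toNNReal_coe]
  have hXm : AEMeasurable X Q := hX.2.1.aemeasurable
  -- In logarithmic coordinates the initial value acts on the payoff by translation.
  set G : ℝ → ℝ := fun y => g (x₀ * Real.exp (-(1 / 2) * v + y)) with hG
  have hGm : Measurable G := hg.comp (by fun_prop)
  have hshift : ∀ θ, Measurable fun y => G (y + θ) := fun θ => hGm.comp (measurable_add_const θ)
  have hprice : ∀ x, 0 < x → ∀ ω, g (futuresPrice ℱ W Q σ x T ω) = G (X ω + Real.log (x / x₀)) := by
    intro x hx ω
    have hint : ∫ u in (0 : ℝ)..(T : ℝ), σ u ^ 2 = v := by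
      rw [intervalIntegral.integral_of_le T.coe_nonneg, hv]
      simp only [sq]
    rw [hG, futuresPrice, stochExp, hint]
    dsimp only
    rw [← add_assoc, Real.exp_add _ (Real.log _), Real.exp_log (div_pos hx hx₀)]
    congr 1
    field_simp
    rfl
  have hprice₀ : ∀ ω, g (futuresPrice ℱ W Q σ x₀ T ω) = G (X ω) := fun ω => by
    rw [hprice x₀ hx₀, div_self hx₀.ne', Real.log_one, add_zero]
  have hG2 : MemLp G 2 (gaussianReal 0 v) := by
    rw [← hlaw, memLp_map_measure_iff hGm.aestronglyMeasurable hXm]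
    simp only [hprice₀] at hg2
    exact hg2
  refine ⟨fun x hx => ?_, ?_⟩
  · simp_rw [hprice x hx]
    have h := integrable_comp_add_gaussianReal hv0 hGm hG2 (Real.log (x / x₀))
    rw [← hlaw, integrable_map_measure
      (hshift _).aestronglyMeasurable hXm] at h
    exact h
  · have hlog : HasDerivAt (fun x => Real.log (x / x₀)) (1 / x₀) x₀ := by
      have h := ((hasDerivAt_id x₀).div_const x₀).log (by simp [hx₀.ne'])
      simpa [hx₀.ne'] using h
    have h := (hasDerivAt_integral_comp_add_gaussianReal hv0 hGm hG2).comp_of_eq x₀ hlog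
      (by simp [hx₀.ne'])
    have hd : ∫ x, G x * x ∂(gaussianReal 0 v) = ∫ ω, g (futuresPrice ℱ W Q σ x₀ T ω) * X ω ∂Q := by
      rw [← hlaw, integral_map hXm (by fun_prop)]
      simp only [hprice₀]
    rw [hd, hv, mul_one_div] at h
    refine h.congr_of_eventuallyEq ?_
    filter_upwards [lt_mem_nhds hx₀] with x hx
    rw [Function.comp_apply, ← hlaw,
      integral_map hXm (hshift _).aestronglyMeasurable]
    exact integral_congr_ae (ae_of_all _ fun ω => hprice x hx ω)

end QuantoDelta

theorem mainTheorem1 {Ω : Type*} {mΩ : MeasurableSpace Ω} (Q : Measure Ω) [IsProbabilityMeasure Q]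
    (ℱ : Filtration ℝ≥0 mΩ) (WE WI : ℝ≥0 → Ω → ℝ)
    (hWE : QuantoDelta.IsFiltrationBrownian ℱ WE Q)
    (hWI : QuantoDelta.IsFiltrationBrownian ℱ WI Q)
    (hindep : IndepFun (fun ω t => WE t ω) (fun ω t => WI t ω) Q)
    (τ₂ : ℝ≥0) (σE σI : ℝ → ℝ)
    (hσE : MemLp σE 2 (volume.restrict (Icc 0 (τ₂ : ℝ))))
    (hσI : MemLp σI 2 (volume.restrict (Icc 0 (τ₂ : ℝ))))
    (hell : QuantoDelta.UniformlyElliptic σE τ₂)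
    (xE xI : ℝ) (hxE : 0 < xE) (hxI : 0 < xI)
    (g h : ℝ → ℝ) (hg : Measurable g) (hh : Measurable h)
    (hg2 : Integrable (fun ω => g (QuantoDelta.futuresPrice ℱ WE Q σE xE τ₂ ω) ^ 2) Q)
    (hh2 : Integrable (fun ω => h (QuantoDelta.futuresPrice ℱ WI Q σI xI τ₂ ω) ^ 2) Q)
    (n : ℕ) (s : Fin n → ℝ) (hs : ∀ i, 0 < s i ∧ s i ≤ τ₂) (hlast : ∃ i, s i = τ₂)
    (a : ℝ → ℝ) (ha : a ∈ QuantoDelta.Upsilon s τ₂) :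
    (∀ x : ℝ, 0 < x → Integrable (fun ω => g (QuantoDelta.futuresPrice ℱ WE Q σE x τ₂ ω)
        * h (QuantoDelta.futuresPrice ℱ WI Q σI xI τ₂ ω)) Q) ∧
    QuantoDelta.ItoIntegrable ℱ WE Q τ₂ (QuantoDelta.deltaIntegrand ℱ WE Q σE xE a) ∧
    Integrable (fun ω => g (QuantoDelta.futuresPrice ℱ WE Q σE xE τ₂ ω)
        * h (QuantoDelta.futuresPrice ℱ WI Q σI xI τ₂ ω)
        * QuantoDelta.deltaWeight ℱ WE Q τ₂ σE xE a ω) Q ∧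
    HasDerivAt (fun x => ∫ ω, g (QuantoDelta.futuresPrice ℱ WE Q σE x τ₂ ω)
        * h (QuantoDelta.futuresPrice ℱ WI Q σI xI τ₂ ω) ∂Q)
      (∫ ω, g (QuantoDelta.futuresPrice ℱ WE Q σE xE τ₂ ω)
        * h (QuantoDelta.futuresPrice ℱ WI Q σI xI τ₂ ω)
        * QuantoDelta.deltaWeight ℱ WE Q τ₂ σE xE a ω ∂Q) xE := by

  have hsub : Ioc 0 (τ₂ : ℝ) ⊆ Icc 0 (τ₂ : ℝ) := Ioc_subset_Icc_self
  have hle := Measure.restrict_mono_set (volume : Measure ℝ) hsub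
  have hσE' := hσE.mono_measure hle
  have hσI' := hσI.mono_measure hle
  have ha' := ha.1.mono_measure hle
  obtain ⟨i, hi⟩ := hlast
  have hT : 0 < τ₂ := by
    have := (hs i).1
    rw [hi] at this
    exact_mod_cast this
  have haT : ∫ t in Ioc 0 (τ₂ : ℝ), a t = 1 := by
    rw [← intervalIntegral.integral_of_le τ₂.coe_nonneg, ← hi]
    exact ha.2 i
  have hb := hell.memLp_mul_inv hσE'.aemeasurable hxE ha'
  have hX := QuantoDelta.isItoIntegral_itoIntegral
    (QuantoDelta.itoIntegrable_deterministic hWE hσE')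
  have hZ := QuantoDelta.isItoIntegral_itoIntegral
    (QuantoDelta.itoIntegrable_deterministic hWI hσI')
  have hBi := QuantoDelta.itoIntegrable_deterministic hWE hb
  rw [← QuantoDelta.deltaIntegrand_eq (ℱ := ℱ) (W := WE) (Q := Q)] at hBi
  have hB : QuantoDelta.IsItoIntegral ℱ WE Q τ₂ (fun t _ => a t * (σE t * xE)⁻¹)
      (QuantoDelta.deltaWeight ℱ WE Q τ₂ σE xE a) := by
    rw [QuantoDelta.deltaWeight, ← QuantoDelta.deltaIntegrand_eq (ℱ := ℱ) (W := WE) (Q := Q)]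
    exact QuantoDelta.isItoIntegral_itoIntegral hBi
  set B := QuantoDelta.deltaWeight ℱ WE Q τ₂ σE xE a
  -- Everything driven by `WE` is independent of everything driven by `WI`.
  have hind := QuantoDelta.indepFun_of_aestronglyMeasurable (IndepFun_iff_Indep _ _ _ |>.1 hindep)
    ((hX.aestronglyMeasurable_comap hWE hσE').prodMk (hB.aestronglyMeasurable_comap hWE hb))
    (hZ.aestronglyMeasurable_comap hWI hσI')
  have hmeas : ∀ (σ : ℝ → ℝ) (x : ℝ), Measurable fun y : ℝ =>
      x * Real.exp (-(1 / 2) * (∫ u in (0 : ℝ)..(τ₂ : ℝ), σ u ^ 2) + y) := fun σ x => by fun_prop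
  have hFm : ∀ x, AEMeasurable (QuantoDelta.futuresPrice ℱ WE Q σE x τ₂) Q := fun x =>
    (hmeas σE x).comp_aemeasurable hX.2.1.aemeasurable
  have hIm : AEMeasurable (QuantoDelta.futuresPrice ℱ WI Q σI xI τ₂) Q :=
    (hmeas σI xI).comp_aemeasurable hZ.2.1.aemeasurable
  have hgm : ∀ x, AEStronglyMeasurable
      (fun ω => g (QuantoDelta.futuresPrice ℱ WE Q σE x τ₂ ω)) Q := fun x =>
    (hg.comp_aemeasurable (hFm x)).aestronglyMeasurable
  have hhm : AEStronglyMeasurable (fun ω => h (QuantoDelta.futuresPrice ℱ WI Q σI xI τ₂ ω)) Q :=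
    (hh.comp_aemeasurable hIm).aestronglyMeasurable
  have hgL : MemLp (fun ω => g (QuantoDelta.futuresPrice ℱ WE Q σE xE τ₂ ω)) 2 Q :=
    (memLp_two_iff_integrable_sq (hgm xE)).2 hg2
  have hhL : Integrable (fun ω => h (QuantoDelta.futuresPrice ℱ WI Q σI xI τ₂ ω)) Q :=
    ((memLp_two_iff_integrable_sq hhm).2 hh2).integrable one_le_two
  have hindF : ∀ x, IndepFun (fun ω => g (QuantoDelta.futuresPrice ℱ WE Q σE x τ₂ ω))
      (fun ω => h (QuantoDelta.futuresPrice ℱ WI Q σI xI τ₂ ω)) Q := fun x =>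
    hind.comp (hg.comp ((hmeas σE x).comp measurable_fst)) (hh.comp (hmeas σI xI))
  have hindB : IndepFun (fun ω => g (QuantoDelta.futuresPrice ℱ WE Q σE xE τ₂ ω) * B ω)
      (fun ω => h (QuantoDelta.futuresPrice ℱ WI Q σI xI τ₂ ω)) Q :=
    hind.comp ((hg.comp ((hmeas σE xE).comp measurable_fst)).mul measurable_snd)
      (hh.comp (hmeas σI xI))
  obtain ⟨hint, hder⟩ := QuantoDelta.integrable_and_hasDerivAt_futuresPrice hWE hT hσE' hell hxE hg
    hgL
  have hgB : Integrable (fun ω => g (QuantoDelta.futuresPrice ℱ WE Q σE xE τ₂ ω) * B ω) Q :=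
    hgL.integrable_mul hB.2.1
  have hcomm : ∀ ω, g (QuantoDelta.futuresPrice ℱ WE Q σE xE τ₂ ω)
      * h (QuantoDelta.futuresPrice ℱ WI Q σI xI τ₂ ω) * B ω
      = g (QuantoDelta.futuresPrice ℱ WE Q σE xE τ₂ ω) * B ω
        * h (QuantoDelta.futuresPrice ℱ WI Q σI xI τ₂ ω) := fun ω => mul_right_comm _ _ _
  simp_rw [hcomm]
  refine ⟨fun x hx => (hindF x).integrable_mul (hint x hx) hhL, hBi,
    hindB.integrable_mul hgB hhL, ?_⟩
  have hXX := hX.integral_mul_deterministic hWE hX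
  have hpos := hell.integral_sq_pos hσE' hT
  -- The normalization of `a` makes the covariance of the weight with `∫ σE dWE` equal to `1 / xE`.
  have hXB : ∫ ω, QuantoDelta.itoIntegral ℱ WE Q τ₂ (fun t _ => σE t) ω * B ω ∂Q = 1 / xE := by
    rw [hX.integral_mul_deterministic hWE hB, ← haT, ← integral_div]
    refine setIntegral_congr_fun measurableSet_Ioc fun t ht => ?_
    have := hell.ne_zero (hsub ht)
    field_simp
  have hreg := QuantoDelta.integral_comp_mul_of_hasGaussianLaw
    (hX.hasGaussianLaw_prodMk hWE hσE' hb hB) (hX.integral_eq_zero hWE hσE')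
    (hB.integral_eq_zero hWE hb) (hXX ▸ hpos.ne') (hg.comp (hmeas σE xE)) hgL
  have hweight : ∫ ω, g (QuantoDelta.futuresPrice ℱ WE Q σE xE τ₂ ω) * B ω ∂Q
      = (∫ ω, g (QuantoDelta.futuresPrice ℱ WE Q σE xE τ₂ ω)
          * QuantoDelta.itoIntegral ℱ WE Q τ₂ (fun t _ => σE t) ω ∂Q)
        / (∫ t in Ioc 0 (τ₂ : ℝ), σE t * σE t) / xE := by
    refine hreg.trans ?_
    rw [hXB, hXX, div_div, div_mul_eq_mul_div, one_mul, div_div, mul_comm xE]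
    rfl
  rw [hindB.integral_fun_mul_eq_mul_integral hgB.1 hhm, hweight]
  refine (hder.mul_const _).congr_of_eventuallyEq (Eventually.of_forall fun x => ?_)
  exact (hindF x).integral_fun_mul_eq_mul_integral (hgm x) hhm
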